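/- Let $R$ be a (finite, crystallographic, reduced) root system spanning a Euclidean space $V$. A basis of a root system $S$ is a subset $B\subseteq S$ that is a vector space basis of the span of $S$ and such that every root of $S$ is a linear combination of roots in $B$ with integer coefficients that are all nonnegative or all nonpositive. For a set $C$ of roots, let $[C]$ be the set of all roots in $R$ that are linear combinations of the roots in $C$ with integer coefficients. A $\pi$-system is a linearly independent set $C\subseteq R$ such that $\alpha-\beta\notin R$ for all $\alpha,\beta\in C$. A $\pi$-system $\Pi'$ is obtained from a $\pi$-system $\Pi$ by an elementary transformation if, for some indecomposable component $K$ of $\Pi$, it is obtained by adjoining to $K$ the lowest root of $[K]$ with respect to the basis $K$ and then removing one root of $K$. Let $C$ be a $\pi$-system in $R$, let $V'$ be the subspace of $V$ spanned by $C$, and let $R'=R\cap V'$. Then: 1. $R'$ is a root subsystem of $R$, and $[C]$ is a root subsystem of $R'$ with basis $C$. 2. There is a basis of $R'$ from which $C$ can be obtained by a finite (possibly empty) sequence of elementary transformations. 3. $C$ can be extended to a basis $B$ of $R$ if and only if $C$ is a basis of $R'$, and $C$ is a basis of $R'$ if and only if $[C]=R'$. -/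

import Mathlib

/-!
Throughout, a root system is a finite, crystallographic, reduced `RootPairing` over `ℝ` satisfying
`RootPairing.IsRootSystem`. A set of roots is represented by the set of its indices
(`P.root` is injective); the whole root system is `Set.univ`.
-/

namespace RootPairing

variable {ι V N : Type*} [AddCommGroup V] [Module ℝ V] [AddCommGroup N] [Module ℝ N]

/-- `R ∩ W`: the roots lying in the subspace `W`. -/
def rootsIn (P : RootPairing ι ℝ V N) (W : Submodule ℝ V) : Set ι :=
  {i | P.root i ∈ W}

/-- `[C]`: the roots that are linear combinations of the roots in `C` with integer coefficients. -/
def bracket (P : RootPairing ι ℝ V N) (C : Set ι) : Set ι :=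
  {i | P.root i ∈ Submodule.span ℤ (P.root '' C)}

/-- A `π`-system: a linearly independent set of roots, no difference of two of which is a root. -/
structure IsPiSystem (P : RootPairing ι ℝ V N) (C : Set ι) : Prop where
  linearIndepOn : LinearIndepOn ℝ P.root C
  sub_notMem : ∀ i ∈ C, ∀ j ∈ C, P.root i - P.root j ∉ Set.range P.root

/-- A set of roots is a root subsystem if it is stable under the reflections in its own roots
(`P.root (P.reflectionPerm i j) = P.reflection i (P.root j)`); it is then a root system in the
subspace that it spans. -/
def IsRootSubsystem (P : RootPairing ι ℝ V N) (S : Set ι) : Prop :=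
  ∀ i ∈ S, ∀ j ∈ S, P.reflectionPerm i j ∈ S

/-- `B` is a basis of the root subsystem `S`: it is a subset of `S` and a vector space basis of the
span of `S`, and each root in `S` is a linear combination of roots in `B` with integral coefficients
that are all nonnegative or all nonpositive. -/
structure IsRootBasis (P : RootPairing ι ℝ V N) (S B : Set ι) : Prop where
  subset : B ⊆ S
  linearIndepOn : LinearIndepOn ℝ P.root B
  span_eq : Submodule.span ℝ (P.root '' B) = Submodule.span ℝ (P.root '' S)
  mem_or_neg_mem : ∀ i ∈ S, P.root i ∈ AddSubmonoid.closure (P.root '' B) ∨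
    -P.root i ∈ AddSubmonoid.closure (P.root '' B)

/-- `K` is an indecomposable component of `C`: a nonempty subset of `C` that is orthogonal to the
rest of `C` and is not the union of two nonempty mutually orthogonal disjoint subsets. -/
structure IsComponent (P : RootPairing ι ℝ V N) (C K : Set ι) : Prop where
  subset : K ⊆ C
  nonempty : K.Nonempty
  orthogonal : ∀ i ∈ K, ∀ j ∈ C \ K, P.IsOrthogonal i j
  indecomposable : ∀ L ⊆ K, L.Nonempty → (∀ i ∈ L, ∀ j ∈ K \ L, P.IsOrthogonal i j) → L = K

/-- `k` is the lowest root of the root system `[K]` with respect to its basis `K`: every root of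
`[K]` differs from it by a linear combination of `K` with nonnegative integral coefficients. -/
structure IsLowestRoot (P : RootPairing ι ℝ V N) (K : Set ι) (k : ι) : Prop where
  mem : k ∈ P.bracket K
  sub_mem : ∀ i ∈ P.bracket K, P.root i - P.root k ∈ AddSubmonoid.closure (P.root '' K)

/-- The `π`-system `C'` is obtained from the `π`-system `C` by an elementary transformation: adjoin
the lowest root `k` to an indecomposable component `K` of `C`, then remove a root `j` of `K`. -/
def ElementaryTransformation (P : RootPairing ι ℝ V N) (C C' : Set ι) : Prop :=
  P.IsPiSystem C ∧ P.IsPiSystem C' ∧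
    ∃ K, P.IsComponent C K ∧ ∃ k, P.IsLowestRoot K k ∧ ∃ j ∈ K, C' = insert k C \ {j}

end RootPairing

/-!
The proof only uses the elementary geometry of roots: two roots at an acute angle differ by a
root.

A `π`-system `C` has no acute angles, so a root of the form `p - q`, with `p` and `q` nonzero sums
over disjoint parts of `C`, could be shortened by subtracting summands until it became the
difference of two elements of `C`. Hence each root in `[C]` has coefficients of only one sign
(`IsPiSystem.sub_notMem_range_root`), and `C` is a basis of `[C]`.

Suppose now that `[C]` is not all of `R'`, and let `T` be minimal among the integrally closed sets
of roots with `[C] ⊂ T ⊆ R'`. Borel and de Siebenthal's description of such pairs is obtained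
without affine Weyl groups. Some linear functional is integral on `C` but not on `T`. Within its
class modulo functionals integral on all roots there is a functional `x` of minimal norm, and
minimality forces `|x| ≤ 1` on the roots; a second minimization makes `x` nonpositive on `C`
(`exists_dual_abs_apply_le_one`). By minimality of `T`, the roots of `T` on which `x` is integral
are exactly those in `[C]`. Let `D` be the basis of `T` defined by the ordering which compares
values of `x` first, and then those of a functional positive on `C`
(`exists_isRootBasis_apply_nonneg`). It meets the zero set of `x` in the same roots as `C`. The
functional `x` may be assumed to vanish off one component `K` of `D`. An element `c` of `C` with
`x c ≠ 0` has `x c = -1`, the least possible value, which makes `c` the lowest root of `[K]`; so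
there is only one such `c`, and, by counting, `D` has only one element on which `x` does not
vanish. Therefore `C` arises from `D` by an elementary transformation
(`IsPiSystem.exists_elementaryTransformation`). Since `[C] ⊂ [D]`, iteration ends at a basis of
`R'`.

The basis `D` adapted to `x` also gives the extension of a basis of `R ∩ W` to one of `R`, with
`x` a functional which vanishes on `W` but on no root outside of `W`.
-/

namespace RootPairing

open Set Module

variable {ι V N : Type*} [AddCommGroup V] [Module ℝ V] [AddCommGroup N] [Module ℝ N]
  {P : RootPairing ι ℝ V N}

/-! ### Sums of roots and linear functionals -/

lemma exists_dual_eq_on {C : Set ι} (hC : LinearIndepOn ℝ P.root C) (a : ι → ℝ) :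
    ∃ f : Dual ℝ V, ∀ i ∈ C, f (P.root i) = a i := by
  obtain ⟨f, hf⟩ := LinearMap.exists_extend ((Basis.span hC).constr ℝ fun i : C ↦ a i)
  refine ⟨f, fun i hi ↦ ?_⟩
  have h := LinearMap.congr_fun hf (Basis.span hC ⟨i, hi⟩)
  rw [Basis.constr_basis] at h
  exact (congrArg (fun v ↦ f v.1) (Basis.span_apply hC ⟨i, hi⟩).symm).trans h

lemma root_mem_closure {S : Set ι} {i : ι} (hi : i ∈ S) :
    P.root i ∈ AddSubmonoid.closure (P.root '' S) :=
  AddSubmonoid.subset_closure ⟨i, hi, rfl⟩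

lemma apply_mem_of_mem_closure {S : Set ι} {v : V} (hv : v ∈ AddSubmonoid.closure (P.root '' S))
    (f : V →ₗ[ℝ] ℝ) (M : AddSubmonoid ℝ) (hf : ∀ i ∈ S, f (P.root i) ∈ M) : f v ∈ M := by
  have : AddSubmonoid.closure (P.root '' S) ≤ M.comap f.toAddMonoidHom := by
    rw [AddSubmonoid.closure_le]
    rintro _ ⟨i, hi, rfl⟩
    exact hf i hi
  exact this hv

lemma apply_nonneg_of_mem_closure {S : Set ι} {v : V}
    (hv : v ∈ AddSubmonoid.closure (P.root '' S)) (f : V →ₗ[ℝ] ℝ)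
    (hf : ∀ i ∈ S, 0 ≤ f (P.root i)) : 0 ≤ f v :=
  apply_mem_of_mem_closure hv f (AddSubmonoid.nonneg ℝ) hf

lemma apply_eq_zero_of_mem_closure {S : Set ι} {v : V}
    (hv : v ∈ AddSubmonoid.closure (P.root '' S)) (f : V →ₗ[ℝ] ℝ)
    (hf : ∀ i ∈ S, f (P.root i) = 0) : f v = 0 :=
  apply_mem_of_mem_closure hv f ⊥ hf

lemma apply_pos_of_mem_closure {S : Set ι} {v : V}
    (hv : v ∈ AddSubmonoid.closure (P.root '' S)) (f : V →ₗ[ℝ] ℝ)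
    (hf : ∀ i ∈ S, 0 < f (P.root i)) (h0 : v ≠ 0) : 0 < f v := by
  suffices v = 0 ∨ 0 < f v from this.resolve_left h0
  clear h0
  induction hv using AddSubmonoid.closure_induction with
  | mem x hx => obtain ⟨i, hi, rfl⟩ := hx; exact Or.inr (hf i hi)
  | zero => simp
  | add x y _ _ hx hy =>
    rcases hx with rfl | hx
    · simpa using hy
    · rcases hy with rfl | hy
      · simpa using Or.inr hx
      · exact Or.inr (by rw [map_add]; positivity)

/-- A functional which is positive on a sum of roots is positive on one of the summands. -/
lemma exists_eq_root_add_of_apply_pos {S : Set ι} {v : V}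
    (hv : v ∈ AddSubmonoid.closure (P.root '' S)) (f : V →ₗ[ℝ] ℝ) (hf : 0 < f v) :
    ∃ i ∈ S, 0 < f (P.root i) ∧ ∃ w ∈ AddSubmonoid.closure (P.root '' S), v = P.root i + w := by
  induction hv using AddSubmonoid.closure_induction with
  | mem x hx => obtain ⟨i, hi, rfl⟩ := hx; exact ⟨i, hi, hf, 0, zero_mem _, by simp⟩
  | zero => simp at hf
  | add x y hx hy ihx ihy =>
    rw [map_add] at hf
    have hor : 0 < f x ∨ 0 < f y := by
      by_contra! h
      linarith
    rcases hor with h | h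
    · obtain ⟨i, hi, hp, w, hw, rfl⟩ := ihx h
      exact ⟨i, hi, hp, w + y, add_mem hw hy, by abel⟩
    · obtain ⟨i, hi, hp, w, hw, rfl⟩ := ihy h
      exact ⟨i, hi, hp, x + w, add_mem hx hw, by abel⟩

lemma closure_le_span_int (S : Set ι) :
    AddSubmonoid.closure (P.root '' S) ≤ (Submodule.span ℤ (P.root '' S)).toAddSubmonoid :=
  AddSubmonoid.closure_le.mpr Submodule.subset_span

lemma span_int_le_span_real {S : Set V} {v : V} (hv : v ∈ Submodule.span ℤ S) :
    v ∈ Submodule.span ℝ S :=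
  Submodule.span_subset_span ℤ ℝ S hv

lemma closure_mono_image {S T : Set ι} (h : S ⊆ T) {v : V}
    (hv : v ∈ AddSubmonoid.closure (P.root '' S)) : v ∈ AddSubmonoid.closure (P.root '' T) :=
  AddSubmonoid.closure_mono (image_mono h) hv

lemma eq_zero_of_mem_closure_of_disjoint {C A D : Set ι} (hC : LinearIndepOn ℝ P.root C)
    (hA : A ⊆ C) (hD : D ⊆ C) (hAD : Disjoint A D) {v : V}
    (h₁ : v ∈ AddSubmonoid.closure (P.root '' A)) (h₂ : v ∈ AddSubmonoid.closure (P.root '' D)) :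
    v = 0 := by
  classical
  obtain ⟨f, hf⟩ := exists_dual_eq_on hC fun i ↦ if i ∈ A then 1 else 0
  by_contra h0
  have := apply_pos_of_mem_closure h₁ f (fun i hi ↦ by simp [hf i (hA hi), hi]) h0
  have := apply_eq_zero_of_mem_closure h₂ f fun i hi ↦ by
    simp [hf i (hD hi), hAD.notMem_of_mem_right hi]
  linarith

lemma exists_eq_sub_of_mem_span_int [Finite ι] {C : Set ι} {v : V}
    (hv : v ∈ Submodule.span ℤ (P.root '' C)) :
    ∃ A ⊆ C, ∃ D ⊆ C, Disjoint A D ∧ ∃ p ∈ AddSubmonoid.closure (P.root '' A),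
      ∃ q ∈ AddSubmonoid.closure (P.root '' D), v = p - q := by
  have := Fintype.ofFinite ι
  obtain ⟨l, hl, rfl⟩ := (Finsupp.mem_span_image_iff_linearCombination ℤ).mp hv
  have hl' : ∀ i, l i ≠ 0 → i ∈ C := fun i hi ↦ hl (Finsupp.mem_support_iff.mpr hi)
  refine ⟨{i | 0 < l i}, fun i hi ↦ hl' i (ne_of_gt hi), {i | l i < 0},
    fun i hi ↦ hl' i (ne_of_lt hi), ?_, ∑ i, (l i).toNat • P.root i, ?_,
    ∑ i, (-l i).toNat • P.root i, ?_, ?_⟩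
  · exact Set.disjoint_left.mpr fun i (h : 0 < l i) (h' : l i < 0) ↦ lt_asymm h h'
  · refine sum_mem fun i _ ↦ ?_
    by_cases h : 0 < l i
    · exact AddSubmonoid.nsmul_mem _ (root_mem_closure (S := {i | 0 < l i}) h) _
    · rw [Int.toNat_of_nonpos (not_lt.mp h), zero_smul]
      exact zero_mem _
  · refine sum_mem fun i _ ↦ ?_
    by_cases h : l i < 0
    · exact AddSubmonoid.nsmul_mem _ (root_mem_closure (S := {i | l i < 0}) h) _
    · have h0 : (-l i).toNat = 0 := Int.toNat_of_nonpos (neg_nonpos.mpr (not_lt.mp h))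
      rw [h0, zero_smul]
      exact zero_mem _
  · rw [Finsupp.linearCombination_apply, Finsupp.sum_fintype _ _ (by simp),
      ← Finset.sum_sub_distrib]
    refine Finset.sum_congr rfl fun i _ ↦ ?_
    rw [← natCast_zsmul, ← natCast_zsmul, ← sub_smul]
    rw [Int.toNat_sub_toNat_neg]

/-! ### Integral spans -/

lemma mem_bracket {C : Set ι} {i : ι} :
    i ∈ P.bracket C ↔ P.root i ∈ Submodule.span ℤ (P.root '' C) :=
  Iff.rfl

lemma subset_bracket (C : Set ι) : C ⊆ P.bracket C :=
  fun _ hi ↦ Submodule.subset_span (mem_image_of_mem _ hi)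

lemma span_bracket (C : Set ι) :
    Submodule.span ℝ (P.root '' P.bracket C) = Submodule.span ℝ (P.root '' C) := by
  refine le_antisymm (Submodule.span_le.mpr ?_)
    (Submodule.span_mono (image_mono (subset_bracket C)))
  rintro _ ⟨i, hi, rfl⟩
  exact span_int_le_span_real hi

/-! ### Angles between roots -/

section Form

variable [Fintype ι]

lemma rootForm_comm (v w : V) : P.RootForm v w = P.RootForm w v :=
  P.rootForm_symmetric.eq v w

variable [P.IsRootSystem]

lemma rootForm_self_pos {v : V} (hv : v ≠ 0) : 0 < P.RootForm v v :=
  P.rootForm_pos_of_ne_zero (by simp) hv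

/-- The sum and the difference of two orthogonal roots are exchanged by a reflection. -/
lemma sub_mem_range_root_of_rootForm_eq_zero {v w : V} (hw : w ∈ range P.root)
    (h : P.RootForm v w = 0) (hvw : v + w ∈ range P.root) :
    v - w ∈ range P.root := by
  obtain ⟨j, rfl⟩ := hw
  obtain ⟨k, hk⟩ := hvw
  have h₁ := P.rootForm_self_smul_coroot j
  have h₂ : P.coroot' j v = 0 := by
    have h₃ : P.RootForm (P.root j) (P.root j) ≠ 0 := (rootForm_self_pos (P.ne_zero j)).ne'
    have h₄ := congrArg (P.toLinearMap v) h₁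
    rw [map_smul, map_nsmul, toLinearMap_apply_apply_Polarization, rootForm_comm (P.root j) v,
      h] at h₄
    simpa [h₃] using h₄
  refine ⟨P.reflectionPerm j k, ?_⟩
  rw [root_reflectionPerm, hk, reflection_apply, map_add, h₂]
  simp [two_smul, sub_eq_add_neg]

variable [P.IsCrystallographic]

lemma pairingIn_pos_of_rootForm_pos {i j : ι} (h : 0 < P.RootForm (P.root i) (P.root j)) :
    0 < P.pairingIn ℤ i j := by
  have h₁ := (P.posRootForm ℝ).two_mul_apply_root_root i j
  have h₂ : 0 < P.RootForm (P.root j) (P.root j) := rootForm_self_pos (P.ne_zero j)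
  change 2 * P.RootForm (P.root i) (P.root j) = P.pairing i j * P.RootForm (P.root j) (P.root j)
    at h₁
  have h₃ : 0 < P.pairing i j := by
    by_contra! h₃
    nlinarith [mul_nonneg (neg_nonneg.mpr h₃) h₂.le]
  rw [← P.algebraMap_pairingIn ℤ] at h₃
  simpa using h₃

lemma sub_mem_range_root {v w : V} (hv : v ∈ range P.root) (hw : w ∈ range P.root)
    (h : 0 < P.RootForm v w) (hne : v ≠ w) : v - w ∈ range P.root := by
  obtain ⟨i, rfl⟩ := hv
  obtain ⟨j, rfl⟩ := hw
  exact P.root_sub_root_mem_of_pairingIn_pos (pairingIn_pos_of_rootForm_pos h)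
    fun hij ↦ hne (by rw [hij])

lemma add_mem_range_root {v w : V} (hv : v ∈ range P.root) (hw : w ∈ range P.root)
    (h : P.RootForm v w < 0) (hne : v ≠ -w) : v + w ∈ range P.root := by
  rw [← sub_neg_eq_add]
  exact sub_mem_range_root hv (P.neg_mem_range_root_iff.mpr hw) (by simpa using h) hne

end Form

/-! ### The positive and negative roots of a `π`-system -/

lemma IsPiSystem.mono {C D : Set ι} (hC : P.IsPiSystem C) (hD : D ⊆ C) : P.IsPiSystem D :=
  ⟨hC.linearIndepOn.mono hD, fun i hi j hj ↦ hC.sub_notMem i (hD hi) j (hD hj)⟩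

section PiSystem

variable [Fintype ι] [P.IsRootSystem] [P.IsCrystallographic]

lemma IsPiSystem.rootForm_nonpos {C : Set ι} (hC : P.IsPiSystem C) {i j : ι} (hi : i ∈ C)
    (hj : j ∈ C) (hij : i ≠ j) : P.RootForm (P.root i) (P.root j) ≤ 0 := by
  by_contra! h
  exact hC.sub_notMem i hi j hj
    (sub_mem_range_root (mem_range_self i) (mem_range_self j) h (P.root.injective.ne hij))

lemma IsPiSystem.rootForm_root_nonpos {C D : Set ι} (hC : P.IsPiSystem C) (hD : D ⊆ C) {i : ι}
    (hi : i ∈ C) (hiD : i ∉ D) {q : V} (hq : q ∈ AddSubmonoid.closure (P.root '' D)) :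
    P.RootForm (P.root i) q ≤ 0 := by
  have := apply_nonneg_of_mem_closure hq (-P.RootForm (P.root i)) fun j hj ↦ by
    have := hC.rootForm_nonpos hi (hD hj) fun h ↦ hiD (h ▸ hj)
    simpa using this
  simpa using this

/-- No root is a linear combination of a `π`-system with coefficients of both signs. Subtracting a
summand at an acute angle reduces such a root to a difference of two elements of the `π`-system. -/
lemma IsPiSystem.sub_notMem_range_root {C A D : Set ι} (hC : P.IsPiSystem C) (hA : A ⊆ C)
    (hD : D ⊆ C) (hAD : Disjoint A D) {p q : V} (hp : p ∈ AddSubmonoid.closure (P.root '' A))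
    (hq : q ∈ AddSubmonoid.closure (P.root '' D)) (hp0 : p ≠ 0) (hq0 : q ≠ 0) :
    p - q ∉ range P.root := by
  obtain ⟨f, hf⟩ := exists_dual_eq_on hC.linearIndepOn fun _ ↦ 1
  obtain ⟨n, hn⟩ := exists_nat_ge (f p + f q)
  induction n generalizing p q with
  | zero =>
    have := apply_pos_of_mem_closure hp f (fun i hi ↦ by simp [hf i (hA hi)]) hp0
    have := apply_pos_of_mem_closure hq f (fun i hi ↦ by simp [hf i (hD hi)]) hq0
    push_cast at hn
    linarith
  | succ n ih =>
    push_cast at hn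
    intro hpq
    obtain ⟨i, hi, hpi, p', hp', rfl⟩ :=
      exists_eq_root_add_of_apply_pos hp (P.RootForm p) (rootForm_self_pos hp0)
    obtain ⟨j, hj, hqj, q', hq', rfl⟩ :=
      exists_eq_root_add_of_apply_pos hq (P.RootForm q) (rootForm_self_pos hq0)
    have hiq := hC.rootForm_root_nonpos hD (hA hi) (hAD.notMem_of_mem_left hi) hq
    have hjp := hC.rootForm_root_nonpos hA (hD hj) (hAD.notMem_of_mem_right hj) hp
    rw [rootForm_comm] at hiq hjp
    rw [map_add, map_add, hf i (hA hi), hf j (hD hj)] at hn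
    by_cases hp'0 : p' = 0
    · by_cases hq'0 : q' = 0
      · subst hp'0 hq'0
        exact hC.sub_notMem i (hA hi) j (hD hj) (by simpa using hpq)
      · refine ih hp hq' hp0 hq'0 (by rw [map_add, hf i (hA hi)]; linarith) ?_
        have := add_mem_range_root hpq (mem_range_self j) (by simp at *; linarith) fun h ↦ hq'0 ?_
        · convert this using 1; abel
        · refine eq_zero_of_mem_closure_of_disjoint hC.linearIndepOn hA hD hAD ?_ hq'
          convert hp using 1
          rw [sub_eq_iff_eq_add] at h
          rw [h]; abel
    · refine ih hp' hq hp'0 hq0 (by rw [map_add, hf j (hD hj)]; linarith) ?_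
      have := sub_mem_range_root hpq (mem_range_self i) (by simp at *; linarith) fun h ↦ hp'0 ?_
      · convert this using 1; abel
      · refine eq_zero_of_mem_closure_of_disjoint hC.linearIndepOn hA hD hAD hp' ?_
        convert hq using 1
        rw [sub_eq_iff_eq_add] at h
        exact add_left_cancel h

lemma IsPiSystem.mem_or_neg_mem_closure {C : Set ι} (hC : P.IsPiSystem C) {v : V}
    (hv : v ∈ range P.root) (hvC : v ∈ Submodule.span ℤ (P.root '' C)) :
    v ∈ AddSubmonoid.closure (P.root '' C) ∨ -v ∈ AddSubmonoid.closure (P.root '' C) := by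
  obtain ⟨A, hA, D, hD, hAD, p, hp, q, hq, rfl⟩ := exists_eq_sub_of_mem_span_int hvC
  by_cases hp0 : p = 0
  · right
    simpa [hp0] using closure_mono_image hD hq
  by_cases hq0 : q = 0
  · left
    simpa [hq0] using closure_mono_image hA hp
  exact (hC.sub_notMem_range_root hA hD hAD hp hq hp0 hq0 hv).elim

theorem IsPiSystem.isRootBasis_bracket {C : Set ι} (hC : P.IsPiSystem C) :
    P.IsRootBasis (P.bracket C) C :=
  ⟨subset_bracket C, hC.linearIndepOn, (span_bracket C).symm,
    fun i hi ↦ hC.mem_or_neg_mem_closure (mem_range_self i) hi⟩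

/-- The positive roots of a `π`-system which is split into two orthogonal parts split as well. If
`v` is a sum of elements of one part and `i` belongs to the other one, then `v + P.root i` is not a
root, since otherwise the reflection in `P.root i` would make `v - P.root i` a root. -/
lemma IsPiSystem.mem_closure_or_mem_closure_diff {C K : Set ι} (hC : P.IsPiSystem C) (hK : K ⊆ C)
    (hKC : ∀ i ∈ K, ∀ j ∈ C \ K, P.RootForm (P.root i) (P.root j) = 0) {v : V}
    (hv : v ∈ range P.root) (hvC : v ∈ AddSubmonoid.closure (P.root '' C)) :
    v ∈ AddSubmonoid.closure (P.root '' K) ∨ v ∈ AddSubmonoid.closure (P.root '' (C \ K)) := by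
  obtain ⟨f, hf⟩ := exists_dual_eq_on hC.linearIndepOn fun _ ↦ 1
  obtain ⟨n, hn⟩ := exists_nat_ge (f v)
  have key {A D : Set ι} (hA : A ⊆ C) (hD : D ⊆ C) (hAD : Disjoint A D)
      (h : ∀ i ∈ A, ∀ j ∈ D, P.RootForm (P.root i) (P.root j) = 0) {i : ι} (hi : i ∈ A) {w : V}
      (hw : w ∈ AddSubmonoid.closure (P.root '' D)) (hw0 : w ≠ 0) :
      P.root i + w ∉ range P.root := by
    intro hiw
    have h0 : P.RootForm w (P.root i) = 0 := by
      rw [rootForm_comm]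
      exact apply_eq_zero_of_mem_closure hw _ (h i hi)
    exact hC.sub_notMem_range_root hD hA hAD.symm hw
      (root_mem_closure hi) hw0 (P.ne_zero i)
      (sub_mem_range_root_of_rootForm_eq_zero (mem_range_self i) h0 (add_comm w _ ▸ hiw))
  induction n generalizing v with
  | zero =>
    have h0 : v ≠ 0 := by obtain ⟨i, rfl⟩ := hv; exact P.ne_zero i
    have := apply_pos_of_mem_closure hvC f (fun i hi ↦ by simp [hf i hi]) h0
    push_cast at hn
    linarith
  | succ n ih =>
    have h0 : v ≠ 0 := by obtain ⟨i, rfl⟩ := hv; exact P.ne_zero i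
    obtain ⟨i, hi, hvi, w, hw, rfl⟩ :=
      exists_eq_root_add_of_apply_pos hvC (P.RootForm v) (rootForm_self_pos h0)
    push_cast at hn
    rw [map_add, hf i hi] at hn
    have hmem {A : Set ι} (hiA : i ∈ A) (hwA : w ∈ AddSubmonoid.closure (P.root '' A)) :
        P.root i + w ∈ AddSubmonoid.closure (P.root '' A) :=
      add_mem (root_mem_closure hiA) hwA
    by_cases hw0 : w = 0
    · subst hw0
      by_cases hiK : i ∈ K
      · exact Or.inl (hmem hiK (zero_mem _))
      · exact Or.inr (hmem ⟨hi, hiK⟩ (zero_mem _))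
    have hwr : w ∈ range P.root := by
      simpa using sub_mem_range_root hv (mem_range_self i) hvi (by simpa using hw0)
    rcases ih hwr hw (by linarith) with h | h
    · by_cases hiK : i ∈ K
      · exact Or.inl (hmem hiK h)
      · refine (key (A := C \ K) sdiff_subset hK disjoint_sdiff_left (fun i hi j hj ↦ ?_)
          ⟨hi, hiK⟩ h hw0 hv).elim
        rw [rootForm_comm]
        exact hKC j hj i hi
    · by_cases hiK : i ∈ K
      · exact (key hK sdiff_subset disjoint_sdiff_right hKC hiK h hw0 hv).elim
      · exact Or.inr (hmem ⟨hi, hiK⟩ h)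

end PiSystem

/-! ### Highest roots -/

lemma one_le_apply_of_mem_closure {S : Set ι} {v : V}
    (hv : v ∈ AddSubmonoid.closure (P.root '' S)) (f : V →ₗ[ℝ] ℝ)
    (hf : ∀ i ∈ S, f (P.root i) = 1) (h0 : v ≠ 0) : 1 ≤ f v := by
  obtain ⟨i, hi, -, w, hw, rfl⟩ := exists_eq_root_add_of_apply_pos hv f
    (apply_pos_of_mem_closure hv f (fun i hi ↦ by simp [hf i hi]) h0)
  have := apply_nonneg_of_mem_closure hw f fun i hi ↦ by simp [hf i hi]
  rw [map_add, hf i hi]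
  linarith

/-- Every sum of roots has a support: a set of roots all of which occur in it. -/
lemma exists_support_of_mem_closure {S : Set ι} {v : V}
    (hv : v ∈ AddSubmonoid.closure (P.root '' S)) :
    ∃ A ⊆ S, v ∈ AddSubmonoid.closure (P.root '' A) ∧
      ∀ i ∈ A, ∃ w ∈ AddSubmonoid.closure (P.root '' A), v = P.root i + w := by
  induction hv using AddSubmonoid.closure_induction with
  | mem x hx =>
    obtain ⟨i, hi, rfl⟩ := hx
    refine ⟨{i}, by simpa using hi, root_mem_closure rfl, ?_⟩
    rintro _ rfl
    exact ⟨0, zero_mem _, by simp⟩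
  | zero => exact ⟨∅, empty_subset _, zero_mem _, by simp⟩
  | add x y _ _ ihx ihy =>
    obtain ⟨A, hA, hxA, hA'⟩ := ihx
    obtain ⟨D, hD, hyD, hD'⟩ := ihy
    have hx := closure_mono_image (P := P) (subset_union_left (s := A) (t := D)) hxA
    have hy := closure_mono_image (P := P) (subset_union_right (s := A) (t := D)) hyD
    refine ⟨A ∪ D, union_subset hA hD, add_mem hx hy, ?_⟩
    rintro i (hi | hi)
    · obtain ⟨w, hw, rfl⟩ := hA' i hi
      exact ⟨w + y, add_mem (closure_mono_image subset_union_left hw) hy, by abel⟩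
    · obtain ⟨w, hw, rfl⟩ := hD' i hi
      exact ⟨x + w, add_mem hx (closure_mono_image subset_union_right hw), by abel⟩

section Highest

variable [Fintype ι] [P.IsRootSystem] [P.IsCrystallographic] {K : Set ι} {v w : V}

lemma rootForm_nonneg_of_add_notMem (hK : P.IsPiSystem K)
    (hv : v ∈ range P.root) (hvK : v ∈ AddSubmonoid.closure (P.root '' K))
    (hmax : ∀ i ∈ K, v + P.root i ∉ range P.root) {i : ι} (hi : i ∈ K) :
    0 ≤ P.RootForm v (P.root i) := by
  by_contra! h
  refine hmax i hi (add_mem_range_root hv (mem_range_self i) h fun h' ↦ ?_)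
  obtain ⟨f, hf⟩ := exists_dual_eq_on hK.linearIndepOn fun _ ↦ 1
  have := apply_nonneg_of_mem_closure hvK f fun i hi ↦ by simp [hf i hi]
  rw [h', map_neg, hf i hi] at this
  linarith

/-- If a root above a dominant positive root `v` exists, then there is one of the form
`v + P.root i`: descend from the larger root by subtracting elements of `K`. -/
lemma exists_add_root_mem_of_add_mem (hK : P.IsPiSystem K)
    (hv0 : v ≠ 0) (hvK : v ∈ AddSubmonoid.closure (P.root '' K))
    (hdom : ∀ i ∈ K, 0 ≤ P.RootForm v (P.root i))
    (hw : w ∈ AddSubmonoid.closure (P.root '' K)) (hw0 : w ≠ 0)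
    (hvw : v + w ∈ range P.root) : ∃ i ∈ K, v + P.root i ∈ range P.root := by
  obtain ⟨f, hf⟩ := exists_dual_eq_on hK.linearIndepOn fun _ ↦ 1
  obtain ⟨n, hn⟩ := exists_nat_ge (f w)
  induction n generalizing w with
  | zero =>
    have := one_le_apply_of_mem_closure hw f hf hw0
    push_cast at hn
    linarith
  | succ n ih =>
    obtain ⟨i, hi, hwi, u, hu, rfl⟩ :=
      exists_eq_root_add_of_apply_pos hw (P.RootForm w) (rootForm_self_pos hw0)
    by_cases hu0 : u = 0
    · exact ⟨i, hi, by simpa [hu0] using hvw⟩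
    push_cast at hn
    rw [map_add, hf i hi] at hn
    refine ih hu hu0 ?_ (by linarith)
    have hpos : 0 < P.RootForm (v + (P.root i + u)) (P.root i) := by
      rw [map_add, LinearMap.add_apply]
      exact add_pos_of_nonneg_of_pos (hdom i hi) hwi
    have := sub_mem_range_root hvw (mem_range_self i) hpos fun h ↦ ?_
    · convert this using 1; abel
    · have h₁ := one_le_apply_of_mem_closure hvK f hf hv0
      have h₂ := one_le_apply_of_mem_closure hu f hf hu0
      have h₃ := congrArg f h
      rw [map_add, map_add] at h₃
      linarith

/-- In an indecomposable root system with basis `K`, a positive root `v` for which no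
`v + P.root i` with `i ∈ K` is a root is the highest root. -/
theorem sub_mem_closure_of_add_notMem (hK : P.IsPiSystem K)
    (hind : ∀ L ⊆ K, L.Nonempty → (∀ i ∈ L, ∀ j ∈ K \ L, P.IsOrthogonal i j) → L = K)
    (hv : v ∈ range P.root) (hvK : v ∈ AddSubmonoid.closure (P.root '' K))
    (hmax : ∀ i ∈ K, v + P.root i ∉ range P.root)
    (hw : w ∈ range P.root) (hwK : w ∈ Submodule.span ℤ (P.root '' K)) :
    v - w ∈ AddSubmonoid.closure (P.root '' K) := by
  rcases (hK.mem_or_neg_mem_closure hw hwK).symm with hw' | hw'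
  · rw [sub_eq_add_neg]
    exact add_mem hvK hw'
  have hv0 : v ≠ 0 := by obtain ⟨i, rfl⟩ := hv; exact P.ne_zero i
  have hdom := fun i hi ↦ rootForm_nonneg_of_add_notMem hK hv hvK hmax (i := i) hi
  -- By indecomposability, every element of `K` occurs in `v`.
  have hfull : ∀ i ∈ K, ∃ u ∈ AddSubmonoid.closure (P.root '' K), v = P.root i + u := by
    obtain ⟨A, hA, hvA, hA'⟩ := exists_support_of_mem_closure hvK
    suffices A = K by rwa [this] at hA'
    refine hind A hA ?_ fun i hi j hj ↦ ?_
    · by_contra h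
      rw [not_nonempty_iff_eq_empty] at h
      subst h
      simp at hvA
      exact hv0 hvA
    · obtain ⟨u, hu, rfl⟩ := hA' i hi
      have h₁ := hdom j hj.1
      have h₂ := hK.rootForm_root_nonpos hA hj.1 hj.2 hu
      have h₃ := hK.rootForm_root_nonpos hA hj.1 hj.2 (root_mem_closure hi)
      rw [rootForm_comm, map_add] at h₁
      have h₄ : P.RootForm (P.root i) (P.root j) = 0 := by rw [rootForm_comm]; linarith
      have h₅ := ((P.posRootForm ℝ).toInvariantForm.apply_root_root_zero_iff i j).mp h₄
      exact ⟨h₅, P.pairing_eq_zero_iff.mp h₅⟩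
  -- It is enough to treat a root `u` of maximal height above `w`.
  obtain ⟨f, hf⟩ := exists_dual_eq_on hK.linearIndepOn fun _ ↦ 1
  obtain ⟨k, hk⟩ := hw
  obtain ⟨m, ⟨hmK, hmw⟩, hmmax⟩ := exists_max_image
    {i | P.root i ∈ AddSubmonoid.closure (P.root '' K) ∧
      P.root i - w ∈ AddSubmonoid.closure (P.root '' K)} (fun i ↦ f (P.root i)) (toFinite _)
    ⟨k, by simpa [hk] using hw'⟩
  suffices v - P.root m ∈ AddSubmonoid.closure (P.root '' K) by
    convert add_mem this hmw using 1; abel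
  have hmdom := fun i hi ↦ rootForm_nonneg_of_add_notMem (i := i) hK (mem_range_self m) hmK (by
    rintro i hi ⟨l, hl⟩
    have := hmmax l ⟨hl ▸ add_mem hmK (root_mem_closure hi), by
      rw [hl, add_sub_right_comm]; exact add_mem hmw (root_mem_closure hi)⟩
    simp only [hl, map_add, hf i hi] at this
    linarith) hi
  obtain ⟨i, hi, hmi, -⟩ := exists_eq_root_add_of_apply_pos hmK (P.RootForm (P.root m))
    (rootForm_self_pos (P.ne_zero m))
  have hpos : 0 < P.RootForm v (P.root m) := by
    obtain ⟨u, hu, rfl⟩ := hfull i hi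
    rw [rootForm_comm, map_add]
    exact add_pos_of_pos_of_nonneg hmi (apply_nonneg_of_mem_closure hu _ hmdom)
  by_cases hne : v = P.root m
  · rw [hne, sub_self]
    exact zero_mem _
  have hsub := sub_mem_range_root hv (mem_range_self m) hpos hne
  refine (hK.mem_or_neg_mem_closure hsub (sub_mem (closure_le_span_int _ hvK)
    (closure_le_span_int _ hmK))).resolve_right fun h ↦ ?_
  obtain ⟨j, hj, hj'⟩ := exists_add_root_mem_of_add_mem hK hv0 hvK hdom h
    (neg_ne_zero.mpr (sub_ne_zero.mpr hne)) (by simp)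
  exact hmax j hj hj'

end Highest

/-! ### Bases adapted to a flag of two functionals -/

lemma isRootBasis_of_mem_or_neg_mem {T B : Set ι} (hB : B ⊆ T)
    (hli : LinearIndepOn ℝ P.root B)
    (h : ∀ i ∈ T, P.root i ∈ AddSubmonoid.closure (P.root '' B) ∨
      -P.root i ∈ AddSubmonoid.closure (P.root '' B)) : P.IsRootBasis T B := by
  refine ⟨hB, hli, le_antisymm (Submodule.span_mono (image_mono hB)) (Submodule.span_le.mpr ?_), h⟩
  rintro _ ⟨i, hi, rfl⟩
  rcases h i hi with h | h
  · exact span_int_le_span_real (closure_le_span_int B h)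
  · exact (Submodule.neg_mem_iff _).mp (span_int_le_span_real (closure_le_span_int B h))

lemma IsRootBasis.subset_bracket {T B : Set ι} (hB : P.IsRootBasis T B) : T ⊆ P.bracket B := by
  intro i hi
  rcases hB.mem_or_neg_mem i hi with h | h
  · exact closure_le_span_int B h
  · exact (Submodule.neg_mem_iff _).mp (closure_le_span_int B h)

lemma bracket_mono {C D : Set ι} (h : C ⊆ D) : P.bracket C ⊆ P.bracket D :=
  fun _ hi ↦ Submodule.span_mono (image_mono h) hi

/-- A linear functional which is positive on a basis determines that basis. -/
lemma IsRootBasis.subset_of_apply_pos {T B D : Set ι} (hB : P.IsRootBasis T B)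
    (hD : P.IsRootBasis T D) (f : Dual ℝ V) (hfB : ∀ i ∈ B, 0 < f (P.root i))
    (hfD : ∀ i ∈ D, 0 < f (P.root i)) : B ⊆ D := by
  have key {B D : Set ι} (hB : P.IsRootBasis T B) (hD : P.IsRootBasis T D)
      (hfB : ∀ i ∈ B, 0 < f (P.root i)) (hfD : ∀ i ∈ D, 0 < f (P.root i)) {i : ι} (hi : i ∈ B) :
      P.root i ∈ AddSubmonoid.closure (P.root '' D) := by
    refine (hD.mem_or_neg_mem i (hB.subset hi)).resolve_right fun h ↦ ?_
    have h₁ := apply_nonneg_of_mem_closure h f fun i hi ↦ (hfD i hi).le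
    rw [map_neg] at h₁
    linarith [hfB i hi]
  intro i hi
  obtain ⟨j, hj, -, w, hw, h⟩ :=
    exists_eq_root_add_of_apply_pos (key hB hD hfB hfD hi) f (hfB i hi)
  obtain ⟨g, hg⟩ := exists_dual_eq_on hB.linearIndepOn fun _ ↦ 1
  have hw' : w ∈ AddSubmonoid.closure (P.root '' B) := by
    refine AddSubmonoid.closure_le.mpr ?_ hw
    rintro _ ⟨l, hl, rfl⟩
    exact key hD hB hfD hfB hl
  by_cases hw0 : w = 0
  · rw [hw0, add_zero] at h
    rwa [P.root.injective h]
  · have h₁ := one_le_apply_of_mem_closure (key hD hB hfD hfB hj) g hg (P.ne_zero j)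
    have h₂ := one_le_apply_of_mem_closure hw' g hg hw0
    have h₃ := congrArg g h
    rw [map_add, hg i hi] at h₃
    linarith

/-- An integrally closed set of roots has a basis on which a given functional, vanishing on none of
its elements, is positive. -/
theorem exists_isRootBasis_apply_pos [Fintype ι] [P.IsRootSystem] [P.IsCrystallographic]
    {T : Set ι} (hT : P.bracket T ⊆ T) (g : Dual ℝ V) (hg : ∀ i ∈ T, g (P.root i) ≠ 0) :
    ∃ B, P.IsRootBasis T B ∧ ∀ i ∈ B, 0 < g (P.root i) := by
  classical
  let _ : InvolutiveNeg T :=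
    { neg i := ⟨P.reflectionPerm i i, hT (by
        rw [mem_bracket, root_reflectionPerm, reflection_apply_self]
        exact neg_mem (Submodule.subset_span ⟨i, i.2, rfl⟩))⟩
      neg_neg i := Subtype.ext (P.indexNeg.neg_neg i.1) }
  let v : T → V := fun i ↦ P.root i
  have hv (i : T) : v (-i) = -v i := by
    change P.root (P.reflectionPerm i i) = _
    rw [root_reflectionPerm, reflection_apply_self]
  let g' : V →+ ℝ := g.toAddMonoidHom
  have hg' (i : T) : g' (v i) ≠ 0 := hg i i.2
  let B := IsAddIndecomposable.baseOf v g'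
  have himage : P.root '' ((↑) '' B : Set ι) = v '' B := by rw [image_image]
  have hpos (i : B) : 0 < g (v i) := IsAddIndecomposable.baseOf_subset_pos v g' i.2
  have hli : LinearIndependent ℝ fun i : B ↦ v i := by
    refine LinearMap.BilinForm.linearIndependent_of_pairwise_le_zero P.RootForm
      (fun w hw ↦ rootForm_self_pos hw) g _ hpos fun i j hij ↦ ?_
    by_contra! h
    have hij' : (i : T) ≠ j := Subtype.coe_injective.ne hij
    refine IsAddIndecomposable.pairwise_baseOf_sub_notMem v hv g' hg' i.2 j.2 hij' ?_
    obtain ⟨k, hk⟩ := sub_mem_range_root (mem_range_self i.1.1) (mem_range_self j.1.1) h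
      (P.root.injective.ne (Subtype.coe_injective.ne hij'))
    refine ⟨⟨k, hT ?_⟩, hk⟩
    rw [mem_bracket, hk]
    exact sub_mem (Submodule.subset_span ⟨i, i.1.2, rfl⟩) (Submodule.subset_span ⟨j, j.1.2, rfl⟩)
  refine ⟨(↑) '' B, isRootBasis_of_mem_or_neg_mem (by rintro _ ⟨i, -, rfl⟩; exact i.2) ?_
    fun i hi ↦ ?_, ?_⟩
  · exact LinearIndepOn.image_of_comp (R := ℝ) (s := B) ((↑) : T → ι) P.root hli
  · rw [himage]
    exact IsAddIndecomposable.mem_or_neg_mem_closure_baseOf v g' ⟨i, hi⟩ (hg' _) (hv _)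
  · rintro _ ⟨i, hi, rfl⟩
    exact hpos ⟨i, hi⟩

lemma mem_closure_setOf_apply_eq_zero {S : Set ι} {v : V}
    (hv : v ∈ AddSubmonoid.closure (P.root '' S)) (f : V →ₗ[ℝ] ℝ)
    (hf : ∀ i ∈ S, 0 ≤ f (P.root i)) (h0 : f v = 0) :
    v ∈ AddSubmonoid.closure (P.root '' {i ∈ S | f (P.root i) = 0}) := by
  induction hv using AddSubmonoid.closure_induction with
  | mem x hx => obtain ⟨i, hi, rfl⟩ := hx; exact root_mem_closure ⟨hi, h0⟩
  | zero => exact zero_mem _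
  | add x y hx hy ihx ihy =>
    have h₁ := apply_nonneg_of_mem_closure hx f hf
    have h₂ := apply_nonneg_of_mem_closure hy f hf
    rw [map_add] at h0
    exact add_mem (ihx (by linarith)) (ihy (by linarith))

/-- The zero set of a functional which is nonnegative on a basis is spanned by part of it. -/
lemma IsRootBasis.setOf_apply_eq_zero {T B : Set ι} (hB : P.IsRootBasis T B) (x : Dual ℝ V)
    (hx : ∀ i ∈ B, 0 ≤ x (P.root i)) :
    P.IsRootBasis {i ∈ T | x (P.root i) = 0} {i ∈ B | x (P.root i) = 0} := by
  refine isRootBasis_of_mem_or_neg_mem (fun i hi ↦ ⟨hB.subset hi.1, hi.2⟩)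
    (hB.linearIndepOn.mono (sep_subset _ _)) fun i hi ↦ ?_
  exact (hB.mem_or_neg_mem i hi.1).imp (fun h ↦ mem_closure_setOf_apply_eq_zero h x hx hi.2)
    fun h ↦ mem_closure_setOf_apply_eq_zero h x hx (by simp [hi.2])

/-- A basis of the zero set of `x` extends to a basis on which `x` is nonnegative: the latter is
determined by the functional `x + ε • f` with `f` positive on the former and `ε` small. -/
theorem exists_isRootBasis_apply_nonneg [Fintype ι] [P.IsRootSystem] [P.IsCrystallographic]
    {T C₀ : Set ι} (hT : P.bracket T ⊆ T) (x : Dual ℝ V)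
    (hC₀ : P.IsRootBasis {i ∈ T | x (P.root i) = 0} C₀) :
    ∃ B, P.IsRootBasis T B ∧ (∀ i ∈ B, 0 ≤ x (P.root i)) ∧ {i ∈ B | x (P.root i) = 0} = C₀ := by
  obtain ⟨f, hf⟩ := exists_dual_eq_on hC₀.linearIndepOn fun _ ↦ 1
  obtain ⟨ε, hε', hε : 0 < ε⟩ : ∃ ε : ℝ, (∀ i, x (P.root i) ≠ 0 →
      ε * |f (P.root i)| < |x (P.root i)|) ∧ 0 < ε := by
    refine Filter.Eventually.exists (f := nhdsWithin 0 (Ioi 0))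
      (Filter.Eventually.and (Filter.eventually_all.mpr fun i ↦ ?_) self_mem_nhdsWithin)
    by_cases hi : x (P.root i) = 0
    · simp [hi]
    have hcont : Continuous fun ε : ℝ ↦ ε * |f (P.root i)| := by fun_prop
    have := (hcont.tendsto 0).eventually_lt_const (u := |x (P.root i)|) (by simpa using hi)
    exact Filter.Eventually.mono (Filter.Eventually.filter_mono nhdsWithin_le_nhds this)
      fun _ h _ ↦ h
  have hfT : ∀ i ∈ T, x (P.root i) = 0 → f (P.root i) ≠ 0 := by
    intro i hi hxi
    rcases hC₀.mem_or_neg_mem i ⟨hi, hxi⟩ with h | h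
    · exact (apply_pos_of_mem_closure h f (fun i hi ↦ by simp [hf i hi]) (P.ne_zero i)).ne'
    · have := apply_pos_of_mem_closure h f (fun i hi ↦ by simp [hf i hi])
        (neg_ne_zero.mpr (P.ne_zero i))
      rw [map_neg] at this
      linarith
  have hlt (i : ι) (hi : x (P.root i) ≠ 0) : |ε * f (P.root i)| < |x (P.root i)| := by
    rw [abs_mul, abs_of_pos hε]
    exact hε' i hi
  obtain ⟨B, hB, hpos⟩ := exists_isRootBasis_apply_pos hT (x + ε • f) (by
    intro i hi h0
    simp only [LinearMap.add_apply, LinearMap.smul_apply, smul_eq_mul] at h0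
    by_cases hxi : x (P.root i) = 0
    · simp [hxi, hε.ne', hfT i hi hxi] at h0
    · have := hlt i hxi
      rw [eq_neg_of_add_eq_zero_left h0, abs_neg] at this
      exact lt_irrefl _ this)
  simp only [LinearMap.add_apply, LinearMap.smul_apply, smul_eq_mul] at hpos
  have hx : ∀ i ∈ B, 0 ≤ x (P.root i) := by
    intro i hi
    by_contra! h
    have h₁ := hlt i h.ne
    rw [abs_of_neg h] at h₁
    linarith [hpos i hi, le_abs_self (ε * f (P.root i))]
  have hB₀ := hB.setOf_apply_eq_zero x hx
  have hfB : ∀ i ∈ {i ∈ B | x (P.root i) = 0}, 0 < f (P.root i) := by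
    rintro i ⟨hi, hxi⟩
    have := hpos i hi
    rw [hxi, zero_add] at this
    exact pos_of_mul_pos_right this hε.le
  exact ⟨B, hB, hx, subset_antisymm
    (hB₀.subset_of_apply_pos hC₀ f hfB fun i hi ↦ by simp [hf i hi])
    (hC₀.subset_of_apply_pos hB₀ f (fun i hi ↦ by simp [hf i hi]) hfB)⟩

/-! ### Reduction of functionals modulo the coweight lattice -/

section Reduction

variable [Fintype ι]

variable (P) in
/-- The Weyl-invariant inner product on the dual of the space of a root system. -/
def dualForm (x y : Dual ℝ V) : ℝ :=
  ∑ i, x (P.root i) * y (P.root i)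

lemma dualForm_comm (x y : Dual ℝ V) : P.dualForm x y = P.dualForm y x := by
  simp only [dualForm, mul_comm]

lemma dualForm_sub_left (x y z : Dual ℝ V) :
    P.dualForm (x - y) z = P.dualForm x z - P.dualForm y z := by
  simp [dualForm, sub_mul, Finset.sum_sub_distrib]

lemma dualForm_smul_left (a : ℝ) (x z : Dual ℝ V) :
    P.dualForm (a • x) z = a * P.dualForm x z := by
  simp [dualForm, mul_assoc, Finset.mul_sum]

lemma dualForm_coroot'_self_pos (j : ι) : 0 < P.dualForm (P.coroot' j) (P.coroot' j) := by
  refine Finset.sum_pos' (fun i _ ↦ mul_self_nonneg _) ⟨j, Finset.mem_univ j, ?_⟩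
  simp

lemma dualForm_reflection (j : ι) (x y : Dual ℝ V) :
    P.dualForm (x - x (P.root j) • P.coroot' j) (y - y (P.root j) • P.coroot' j) =
      P.dualForm x y := by
  unfold dualForm
  rw [← Equiv.sum_comp (P.reflectionPerm j) fun i ↦ x (P.root i) * y (P.root i)]
  refine Finset.sum_congr rfl fun i _ ↦ ?_
  simp only [root_reflectionPerm, reflection_apply, map_sub, map_smul, LinearMap.sub_apply,
    LinearMap.smul_apply, smul_eq_mul]
  ring

lemma two_mul_dualForm_coroot' (x : Dual ℝ V) (j : ι) :
    2 * P.dualForm x (P.coroot' j) =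
      x (P.root j) * P.dualForm (P.coroot' j) (P.coroot' j) := by
  have h := P.dualForm_reflection j x (P.coroot' j)
  have h₁ : P.coroot' j - P.coroot' j (P.root j) • P.coroot' j =
      (-1 : ℝ) • P.coroot' j := by
    rw [root_coroot'_eq_pairing, pairing_same]
    module
  rw [h₁, dualForm_comm, dualForm_smul_left, dualForm_comm, dualForm_sub_left,
    dualForm_smul_left] at h
  linarith

variable [P.IsRootSystem]

lemma finite_setOf_dualForm_le (x₀ : Dual ℝ V) (M : ℝ) :
    {x : Dual ℝ V | (∀ i, ∃ n : ℤ, x (P.root i) = x₀ (P.root i) + n) ∧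
      P.dualForm x x ≤ M}.Finite := by
  have hinj : Function.Injective fun (x : Dual ℝ V) (i : ι) ↦ x (P.root i) := by
    intro x y hxy
    refine LinearMap.ext_on_range (v := P.root) (IsRootSystem.span_root_eq_top (P := P))
      fun i ↦ congrFun hxy i
  refine Finite.of_finite_image (Set.Finite.subset (Finite.pi fun i : ι ↦
    (finite_Icc ⌊-(M + 1) - x₀ (P.root i)⌋ ⌈M + 1 - x₀ (P.root i)⌉).image
      fun n : ℤ ↦ x₀ (P.root i) + n) ?_) hinj.injOn
  rintro _ ⟨x, ⟨hx, hM⟩, rfl⟩ i -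
  obtain ⟨n, hn⟩ := hx i
  refine ⟨n, ?_, hn.symm⟩
  have h₁ : x (P.root i) * x (P.root i) ≤ M :=
    (Finset.single_le_sum (f := fun i ↦ x (P.root i) * x (P.root i))
      (fun _ _ ↦ mul_self_nonneg _) (Finset.mem_univ i)).trans hM
  have h₂ : x (P.root i) ≤ M + 1 := by nlinarith [sq_nonneg (x (P.root i) - 1)]
  have h₃ : -(M + 1) ≤ x (P.root i) := by nlinarith [sq_nonneg (x (P.root i) + 1)]
  constructor
  · exact_mod_cast (Int.floor_le _).trans (by linarith : -(M + 1) - x₀ (P.root i) ≤ n)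
  · exact_mod_cast (by linarith : (n : ℝ) ≤ M + 1 - x₀ (P.root i)).trans (Int.le_ceil _)

/-- Modulo functionals which are integral on the roots, every functional is bounded by `1` on the
roots. If it is integral on `C`, it may be chosen nonpositive there.

A functional of minimal norm in its class is bounded by `1`, since otherwise subtracting a coroot
would decrease the norm; if, among those of minimal norm, its inner product with some `f` which is
positive on `C` is also minimal, then it is nonpositive on `C`, since otherwise a reflection in a
root of `C` would decrease that inner product. -/
theorem exists_dual_abs_apply_le_one [P.IsCrystallographic] {C : Set ι}
    (hC : LinearIndepOn ℝ P.root C) (x₀ : Dual ℝ V) (hx₀ : ∀ i ∈ C, ∃ n : ℤ, x₀ (P.root i) = n) :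
    ∃ x : Dual ℝ V, (∀ i, ∃ n : ℤ, x (P.root i) = x₀ (P.root i) + n) ∧
      (∀ i, |x (P.root i)| ≤ 1) ∧ ∀ i ∈ C, x (P.root i) ≤ 0 := by
  obtain ⟨f, hf⟩ := exists_dual_eq_on hC fun _ ↦ 1
  obtain ⟨x, ⟨hx, hxM⟩, hmin⟩ := exists_min_image _
    (fun x ↦ toLex (P.dualForm x x, P.dualForm x f))
    (P.finite_setOf_dualForm_le x₀ (P.dualForm x₀ x₀)) ⟨x₀, fun i ↦ ⟨0, by simp⟩, le_rfl⟩
  have hmem (n : ℤ) (j i : ι) :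
      ∃ m : ℤ, (x - (n : ℝ) • P.coroot' j) (P.root i) = x₀ (P.root i) + m := by
    obtain ⟨m, hm⟩ := hx i
    refine ⟨m - n * P.pairingIn ℤ i j, ?_⟩
    have : P.pairing i j = (P.pairingIn ℤ i j : ℝ) := by
      rw [← P.algebraMap_pairingIn ℤ]; simp
    simp only [LinearMap.sub_apply, LinearMap.smul_apply, smul_eq_mul, root_coroot'_eq_pairing, hm,
      this]
    push_cast
    ring
  have hle (i : ι) : x (P.root i) ≤ 1 := by
    by_contra! h
    have h₁ := P.dualForm_coroot'_self_pos i
    have h₂ := P.two_mul_dualForm_coroot' x i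
    have h₃ : P.dualForm (x - (1 : ℤ) • P.coroot' i) (x - (1 : ℤ) • P.coroot' i) <
        P.dualForm x x := by
      rw [one_smul, dualForm_sub_left, dualForm_comm, dualForm_sub_left, dualForm_comm _ (_ - _),
        dualForm_sub_left, P.dualForm_comm (P.coroot' i) x]
      nlinarith
    have h₄ := hmin (x - (1 : ℤ) • P.coroot' i)
      ⟨by simpa using hmem 1 i, h₃.le.trans hxM⟩
    rw [Prod.Lex.toLex_le_toLex] at h₄
    rcases h₄ with h₄ | h₄
    · exact lt_asymm h₃ h₄
    · exact h₃.ne' h₄.1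
  refine ⟨x, hx, fun i ↦ abs_le.mpr ⟨?_, hle i⟩, fun i hi ↦ ?_⟩
  · have := hle (P.reflectionPerm i i)
    rw [root_reflectionPerm, reflection_apply_self, map_neg] at this
    linarith
  · by_contra! h
    obtain ⟨n, hn⟩ : ∃ n : ℤ, x (P.root i) = n := by
      obtain ⟨n, hn⟩ := hx i
      obtain ⟨m, hm⟩ := hx₀ i hi
      exact ⟨m + n, by rw [hn, hm]; push_cast; ring⟩
    have h₁ := P.dualForm_coroot'_self_pos i
    have h₂ := P.two_mul_dualForm_coroot' f i
    have h₃ := P.dualForm_reflection i x x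
    have h₄ := hmin (x - x (P.root i) • P.coroot' i) ⟨hn ▸ hmem n i, h₃.le.trans hxM⟩
    rw [Prod.Lex.toLex_le_toLex] at h₄
    rcases h₄ with h₄ | h₄
    · exact h₄.ne h₃.symm
    · have h₅ := h₄.2
      simp only at h₅
      rw [dualForm_sub_left, dualForm_smul_left, P.dualForm_comm (P.coroot' i) f] at h₅
      rw [hf i hi] at h₂
      nlinarith [mul_pos h (by linarith : 0 < P.dualForm f (P.coroot' i))]

end Reduction

/-! ### Components and bases of integrally closed sets of roots -/

lemma exists_isComponent {C : Set ι} {j : ι} (hj : j ∈ C) : ∃ K, P.IsComponent C K ∧ j ∈ K := by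
  let K : Set ι := {i ∈ C | ∀ A ⊆ C, j ∈ A → (∀ a ∈ A, ∀ b ∈ C \ A, P.IsOrthogonal a b) → i ∈ A}
  have hsub {A : Set ι} (hA : A ⊆ C) (hjA : j ∈ A)
      (h : ∀ a ∈ A, ∀ b ∈ C \ A, P.IsOrthogonal a b) : K ⊆ A := fun i hi ↦ hi.2 A hA hjA h
  have hjK : j ∈ K := ⟨hj, fun _ _ h _ ↦ h⟩
  have horth : ∀ a ∈ K, ∀ b ∈ C \ K, P.IsOrthogonal a b := by
    rintro a ha b ⟨hb, hbK⟩
    have : ∃ A ⊆ C, j ∈ A ∧ (∀ a ∈ A, ∀ b ∈ C \ A, P.IsOrthogonal a b) ∧ b ∉ A := by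
      by_contra! h
      exact hbK ⟨hb, fun A hA hjA hAC ↦ h A hA hjA hAC⟩
    obtain ⟨A, hA, hjA, hAC, hbA⟩ := this
    exact hAC a (hsub hA hjA hAC ha) b ⟨hb, hbA⟩
  have hKC : K ⊆ C := sep_subset _ _
  refine ⟨K, ⟨hKC, ⟨j, hjK⟩, horth, fun L hL hL0 hLK ↦ ?_⟩, hjK⟩
  by_cases hjL : j ∈ L
  · refine subset_antisymm hL (hsub (hL.trans hKC) hjL fun a ha b hb ↦ ?_)
    by_cases hbK : b ∈ K
    · exact hLK a ha b ⟨hbK, hb.2⟩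
    · exact horth a (hL ha) b ⟨hb.1, hbK⟩
  · obtain ⟨l, hl⟩ := hL0
    refine ((hsub (A := K \ L) (sdiff_subset.trans hKC) ⟨hjK, hjL⟩ fun a ha b hb ↦ ?_)
      (hL hl)).2 hl |>.elim
    by_cases hbK : b ∈ K
    · have hbL : b ∈ L := by
        by_contra hbL
        exact hb.2 ⟨hbK, hbL⟩
      exact (hLK b hbL a ha).symm
    · exact horth a ha.1 b ⟨hb.1, hbK⟩

lemma IsRootBasis.bracket_eq {T B : Set ι} (hT : P.bracket T ⊆ T) (hB : P.IsRootBasis T B) :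
    P.bracket B = T :=
  ((bracket_mono hB.subset).trans hT).antisymm hB.subset_bracket

lemma IsRootBasis.isPiSystem {T B : Set ι} (hT : P.bracket T ⊆ T) (hB : P.IsRootBasis T B) :
    P.IsPiSystem B := by
  classical
  refine ⟨hB.linearIndepOn, ?_⟩
  rintro i hi j hj ⟨k, hk⟩
  have hij : i ≠ j := by
    rintro rfl
    rw [sub_self] at hk
    exact P.ne_zero k hk
  have hkT : k ∈ T := hT (by
    rw [mem_bracket, hk]
    exact sub_mem (Submodule.subset_span ⟨i, hB.subset hi, rfl⟩)
      (Submodule.subset_span ⟨j, hB.subset hj, rfl⟩))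
  have key {i j : ι} (hi : i ∈ B) (hj : j ∈ B) (hij : i ≠ j) :
      P.root i - P.root j ∉ AddSubmonoid.closure (P.root '' B) := by
    intro h
    obtain ⟨f, hf⟩ := exists_dual_eq_on hB.linearIndepOn fun l ↦ if l = j then 1 else 0
    have := apply_nonneg_of_mem_closure h f fun l hl ↦ by
      rw [hf l hl]
      split_ifs <;> norm_num
    rw [map_sub, hf i hi, hf j hj, if_neg hij, if_pos rfl] at this
    linarith
  rcases hB.mem_or_neg_mem k hkT with h | h
  · exact key hi hj hij (hk ▸ h)
  · rw [hk, neg_sub] at h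
    exact key hj hi hij.symm h

lemma IsRootBasis.ncard_eq [Finite ι] {T B D : Set ι} (hB : P.IsRootBasis T B)
    (hD : LinearIndepOn ℝ P.root D)
    (h : Submodule.span ℝ (P.root '' D) = Submodule.span ℝ (P.root '' T)) :
    B.ncard = D.ncard := by
  have key {D : Set ι} (hD : LinearIndepOn ℝ P.root D) :
      D.ncard = finrank ℝ (Submodule.span ℝ (P.root '' D)) := by
    have := Fintype.ofFinite D
    have := finrank_span_eq_card (b := fun i : D ↦ P.root i) hD
    rw [← image_eq_range] at this
    rw [this, ← Nat.card_eq_fintype_card, Nat.card_coe_set_eq]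
  rw [key hB.linearIndepOn, key hD, h, hB.span_eq]

/-! ### Inverting elementary transformations -/

lemma IsLowestRoot.unique {K : Set ι} (hK : P.IsPiSystem K) {k l : ι} (hk : P.IsLowestRoot K k)
    (hl : P.IsLowestRoot K l) : k = l := by
  obtain ⟨f, hf⟩ := exists_dual_eq_on hK.linearIndepOn fun _ ↦ 1
  have h₁ := apply_nonneg_of_mem_closure (hk.sub_mem l hl.mem) f fun i hi ↦ by simp [hf i hi]
  by_contra hne
  have h₂ := apply_pos_of_mem_closure (hl.sub_mem k hk.mem) f (fun i hi ↦ by simp [hf i hi])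
    (sub_ne_zero.mpr (P.root.injective.ne hne))
  rw [map_sub] at h₁ h₂
  linarith

lemma exists_int_of_mem_span_int {C : Set ι} {v : V} (hv : v ∈ Submodule.span ℤ (P.root '' C))
    (x : Dual ℝ V) (hx : ∀ i ∈ C, ∃ n : ℤ, x (P.root i) = n) : ∃ n : ℤ, x v = n := by
  induction hv using Submodule.span_induction with
  | mem v hv => obtain ⟨i, hi, rfl⟩ := hv; exact hx i hi
  | zero => exact ⟨0, by simp⟩
  | add v w _ _ hv hw =>
    obtain ⟨n, hn⟩ := hv
    obtain ⟨m, hm⟩ := hw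
    exact ⟨n + m, by simp [hn, hm]⟩
  | smul a v _ hv =>
    obtain ⟨n, hn⟩ := hv
    exact ⟨a * n, by rw [map_zsmul, hn, zsmul_eq_mul]; push_cast; rfl⟩

lemma exists_dual_not_int {C : Set ι} (hC : LinearIndepOn ℝ P.root C) {v : V}
    (hv : v ∈ Submodule.span ℝ (P.root '' C)) (hv' : v ∉ Submodule.span ℤ (P.root '' C)) :
    ∃ x : Dual ℝ V, (∀ i ∈ C, ∃ n : ℤ, x (P.root i) = n) ∧ ∀ n : ℤ, x v ≠ n := by
  classical
  by_contra! h
  obtain ⟨l, hl, rfl⟩ := (Finsupp.mem_span_image_iff_linearCombination ℝ).mp hv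
  have hl' : ∀ i, l i ≠ 0 → i ∈ C := fun i hi ↦ hl (Finsupp.mem_support_iff.mpr hi)
  refine hv' ?_
  rw [Finsupp.linearCombination_apply, Finsupp.sum]
  refine sum_mem fun i hi ↦ ?_
  have hiC : i ∈ C := hl hi
  obtain ⟨x, hx⟩ := exists_dual_eq_on hC fun j ↦ if j = i then 1 else 0
  obtain ⟨n, hn⟩ := h x fun j hj ↦ ⟨if j = i then 1 else 0, by rw [hx j hj]; split_ifs <;> simp⟩
  have : x (Finsupp.linearCombination ℝ P.root l) = l i := by
    rw [Finsupp.linearCombination_apply, Finsupp.sum, map_sum, Finset.sum_eq_single i]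
    · simp [hx i hiC]
    · intro j hj hji
      simp [hx j (hl hj), hji]
    · intro h'
      exact (h' hi).elim
  rw [← this, hn, Int.cast_smul_eq_zsmul]
  exact Submodule.smul_mem _ _ (Submodule.subset_span ⟨i, hiC, rfl⟩)

/-- Among the integrally closed sets `T` of roots strictly containing `[C]` in the subspace spanned
by `C`, a minimal one has the property that a functional which is integral on `C` but not on `T` is
not integral on any root of `T` outside of `[C]`. -/
lemma exists_minimal_closed [Finite ι] {C : Set ι}
    (h : P.bracket C ≠ P.rootsIn (Submodule.span ℝ (P.root '' C))) :
    ∃ T, P.bracket T ⊆ T ∧ P.bracket C ⊂ T ∧ T ⊆ P.rootsIn (Submodule.span ℝ (P.root '' C)) ∧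
      ∀ x : Dual ℝ V, (∀ i ∈ C, ∃ n : ℤ, x (P.root i) = n) →
        (∃ i ∈ T, ∀ n : ℤ, x (P.root i) ≠ n) →
        ∀ i ∈ T, (∃ n : ℤ, x (P.root i) = n) → i ∈ P.bracket C := by
  obtain ⟨T, ⟨hT, hCT, hTC⟩, hmin⟩ := exists_min_image
    {T | P.bracket T ⊆ T ∧ P.bracket C ⊂ T ∧ T ⊆ P.rootsIn (Submodule.span ℝ (P.root '' C))}
    ncard (toFinite _) ⟨P.rootsIn (Submodule.span ℝ (P.root '' C)), fun i hi ↦ by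
        change P.root i ∈ Submodule.span ℝ (P.root '' C)
        refine Submodule.span_le.mpr ?_ (span_int_le_span_real hi)
        rintro _ ⟨j, hj, rfl⟩
        exact hj,
      ssubset_iff_subset_ne.mpr ⟨fun i hi ↦ span_int_le_span_real hi, h⟩, subset_rfl⟩
  refine ⟨T, hT, hCT, hTC, fun x hx ⟨j, hj, hxj⟩ i hi hxi ↦ ?_⟩
  by_contra hiC
  have hlt : {i ∈ T | ∃ n : ℤ, x (P.root i) = n}.ncard < T.ncard := by
    refine ncard_lt_ncard ((ssubset_iff_of_subset (sep_subset _ _)).mpr ⟨j, hj, ?_⟩)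
    rintro ⟨-, n, hn⟩
    exact hxj n hn
  refine hlt.not_ge (hmin {i ∈ T | ∃ n : ℤ, x (P.root i) = n}
    ⟨fun k hk ↦ ⟨?_, ?_⟩, ?_, (sep_subset _ _).trans hTC⟩)
  · exact hT (bracket_mono (sep_subset _ _) hk)
  · exact exists_int_of_mem_span_int hk x fun i hi ↦ hi.2
  · have hsub : P.bracket C ⊆ {i ∈ T | ∃ n : ℤ, x (P.root i) = n} := fun k hk ↦
      ⟨hCT.subset hk, exists_int_of_mem_span_int hk x hx⟩
    exact (ssubset_iff_of_subset hsub).mpr ⟨i, ⟨hi, hxi⟩, hiC⟩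

/-- The functional `x` is a vertex of the arrangement of the affine hyperplanes on which a root in
`T` is integral; it lies in the closure of an alcove touching the origin and in the chamber on which
the roots in `C` are nonpositive. The roots in `C` are integral at `x`, but not all roots in `T`
are. -/
structure IsAlcoveVertex (P : RootPairing ι ℝ V N) (T C : Set ι) (x : Dual ℝ V) : Prop where
  exists_int : ∀ i ∈ C, ∃ n : ℤ, x (P.root i) = n
  exists_not_int : ∃ i ∈ T, ∀ n : ℤ, x (P.root i) ≠ n
  abs_le_one : ∀ i ∈ T, |x (P.root i)| ≤ 1
  nonpos : ∀ i ∈ C, x (P.root i) ≤ 0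

section Elementary

variable [Fintype ι] [P.IsRootSystem] [P.IsCrystallographic]

lemma IsPiSystem.mem_closure_component {C K : Set ι} (hC : P.IsPiSystem C)
    (hK : P.IsComponent C K) {v : V} (hv : v ∈ range P.root)
    (hvC : v ∈ AddSubmonoid.closure (P.root '' C)) :
    v ∈ AddSubmonoid.closure (P.root '' K) ∨ v ∈ AddSubmonoid.closure (P.root '' (C \ K)) :=
  hC.mem_closure_or_mem_closure_diff hK.subset (fun i hi j hj ↦
    ((P.posRootForm ℝ).toInvariantForm.apply_root_root_zero_iff i j).mpr
      (hK.orthogonal i hi j hj).1) hv hvC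

lemma IsLowestRoot.of_add_notMem {C K : Set ι} (hC : P.IsPiSystem C) (hK : P.IsComponent C K)
    {k : ι} (hk : -P.root k ∈ AddSubmonoid.closure (P.root '' K))
    (hmax : ∀ i ∈ K, -P.root k + P.root i ∉ range P.root) : P.IsLowestRoot K k := by
  refine ⟨?_, fun i hi ↦ ?_⟩
  · rw [mem_bracket, ← neg_mem_iff]
    exact closure_le_span_int K hk
  · have := sub_mem_closure_of_add_notMem (hC.mono hK.subset) hK.indecomposable
      (P.neg_mem_range_root_iff.mpr (mem_range_self k)) hk hmax
      (P.neg_mem_range_root_iff.mpr (mem_range_self i)) (neg_mem hi)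
    convert this using 1
    abel

lemma exists_isAlcoveVertex {T C : Set ι} (hC : P.IsPiSystem C) (hCT : P.bracket C ⊂ T)
    (hTC : T ⊆ P.rootsIn (Submodule.span ℝ (P.root '' C))) : ∃ x, P.IsAlcoveVertex T C x := by
  obtain ⟨i, hiT, hiC⟩ := exists_of_ssubset hCT
  obtain ⟨x₀, hx₀, hx₀i⟩ := exists_dual_not_int hC.linearIndepOn (hTC hiT) hiC
  obtain ⟨x, hx, hx₁, hxC⟩ := exists_dual_abs_apply_le_one hC.linearIndepOn x₀ hx₀
  refine ⟨x, fun j hj ↦ ?_, ⟨i, hiT, fun n hn ↦ ?_⟩, fun j _ ↦ hx₁ j, hxC⟩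
  · obtain ⟨n, hn⟩ := hx j
    obtain ⟨m, hm⟩ := hx₀ j hj
    exact ⟨m + n, by rw [hn, hm]; push_cast; rfl⟩
  · obtain ⟨m, hm⟩ := hx i
    exact hx₀i (n - m) (by push_cast; linarith)

/-- A functional as in `IsAlcoveVertex` may be replaced by the functional which agrees with it on
one component of a basis of `T` and which vanishes on the other ones. -/
lemma IsAlcoveVertex.exists_apply_eq_zero {T C : Set ι} (hT : P.bracket T ⊆ T) (hCT : C ⊆ T)
    {x : Dual ℝ V} (hx : P.IsAlcoveVertex T C x) {B K : Set ι} (hB : P.IsRootBasis T B)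
    (hK : P.IsComponent B K) {j : ι} (hj : j ∈ K) (hxj : ∀ n : ℤ, x (P.root j) ≠ n) :
    ∃ y, P.IsAlcoveVertex T C y ∧ (∀ i ∈ B \ K, y (P.root i) = 0) ∧
      ∀ i ∈ T, y (P.root i) ≠ 0 → x (P.root i) ≠ 0 := by
  classical
  have hBpi := hB.isPiSystem hT
  obtain ⟨y, hy⟩ := exists_dual_eq_on hB.linearIndepOn fun i ↦ if i ∈ K then x (P.root i) else 0
  have hyK {v : V} (hv : v ∈ AddSubmonoid.closure (P.root '' K)) : y v = x v := by
    have := apply_eq_zero_of_mem_closure hv (y - x) fun i hi ↦ by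
      simp [hy i (hK.subset hi), hi]
    exact sub_eq_zero.mp this
  have hyB {v : V} (hv : v ∈ AddSubmonoid.closure (P.root '' (B \ K))) : y v = 0 :=
    apply_eq_zero_of_mem_closure hv y fun i hi ↦ by simp [hy i hi.1, hi.2]
  have key (i : ι) (hi : i ∈ T) : y (P.root i) = x (P.root i) ∨ y (P.root i) = 0 := by
    rcases hB.mem_or_neg_mem i hi with h | h
    · exact (hBpi.mem_closure_component hK (mem_range_self i) h).imp hyK hyB
    · refine (hBpi.mem_closure_component hK (P.neg_mem_range_root_iff.mpr (mem_range_self i))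
        h).imp (fun h ↦ ?_) fun h ↦ ?_
      · simpa using hyK h
      · simpa using hyB h
  refine ⟨y, ⟨fun i hi ↦ ?_, ⟨j, hB.subset (hK.subset hj), ?_⟩, fun i hi ↦ ?_, fun i hi ↦ ?_⟩,
    fun i hi ↦ hyB (root_mem_closure hi), fun i hi h ↦ ?_⟩
  · rcases key i (hCT hi) with h | h
    · rw [h]
      exact hx.exists_int i hi
    · exact ⟨0, by simp [h]⟩
  · rw [hyK (root_mem_closure hj)]
    exact hxj
  · rcases key i hi with h | h
    · rw [h]
      exact hx.abs_le_one i hi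
    · simp [h]
  · rcases key i (hCT hi) with h | h
    · rw [h]
      exact hx.nonpos i hi
    · exact h.le
  · rwa [(key i hi).resolve_right h] at h

/-- A `π`-system `C` such that `[C]` does not consist of all roots in the subspace spanned by `C`
arises by an elementary transformation from a `π`-system with a larger set `[D]`. -/
theorem IsPiSystem.exists_elementaryTransformation {C : Set ι} (hC : P.IsPiSystem C)
    (h : P.bracket C ≠ P.rootsIn (Submodule.span ℝ (P.root '' C))) :
    ∃ D, P.ElementaryTransformation D C ∧ P.bracket C ⊂ P.bracket D ∧
      Submodule.span ℝ (P.root '' D) = Submodule.span ℝ (P.root '' C) := by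
  obtain ⟨T, hT, hCT, hTC, hint⟩ := exists_minimal_closed h
  have hCT' : C ⊆ T := (subset_bracket C).trans hCT.subset
  have hspan : Submodule.span ℝ (P.root '' C) = Submodule.span ℝ (P.root '' T) := by
    refine le_antisymm (Submodule.span_mono (image_mono hCT')) (Submodule.span_le.mpr ?_)
    rintro _ ⟨i, hi, rfl⟩
    exact hTC hi
  -- A vertex which is nonzero on as few roots as possible vanishes on all components but one.
  obtain ⟨x, hx, hxmin⟩ := WellFounded.has_min
    (measure fun x : Dual ℝ V ↦ {i ∈ T | x (P.root i) ≠ 0}.ncard).wf {x | P.IsAlcoveVertex T C x}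
    (exists_isAlcoveVertex hC hCT hTC)
  have hC₀ : P.IsRootBasis {i ∈ T | x (P.root i) = 0} {i ∈ C | x (P.root i) = 0} := by
    have h₁ := hC.isRootBasis_bracket.setOf_apply_eq_zero (-x) fun i hi ↦ by
      simpa using hx.nonpos i hi
    simp only [LinearMap.neg_apply, neg_eq_zero] at h₁
    convert h₁ using 1
    ext i
    refine ⟨fun hi ↦ ⟨hint x hx.exists_int hx.exists_not_int i hi.1 ⟨0, by simp [hi.2]⟩, hi.2⟩,
      fun hi ↦ ⟨hCT.subset hi.1, hi.2⟩⟩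
  obtain ⟨D, hD, hxD, hDC⟩ := exists_isRootBasis_apply_nonneg hT x hC₀
  have hDpi := hD.isPiSystem hT
  obtain ⟨j, hjD, hxj⟩ : ∃ j ∈ D, ∀ n : ℤ, x (P.root j) ≠ n := by
    by_contra! h'
    obtain ⟨i, hi, hxi⟩ := hx.exists_not_int
    obtain ⟨n, hn⟩ := exists_int_of_mem_span_int (hD.subset_bracket hi) x h'
    exact hxi n hn
  obtain ⟨K, hK, hjK⟩ := exists_isComponent (P := P) hjD
  have hxK : ∀ i ∈ D \ K, x (P.root i) = 0 := by
    obtain ⟨y, hy, hyD, hyx⟩ := hx.exists_apply_eq_zero hT hCT' hD hK hjK hxj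
    have hle : {i ∈ T | x (P.root i) ≠ 0}.ncard ≤ {i ∈ T | y (P.root i) ≠ 0}.ncard :=
      not_lt.mp (hxmin y hy)
    have heq := eq_of_subset_of_ncard_le (fun i (hi : i ∈ {i ∈ T | y (P.root i) ≠ 0}) ↦
      (⟨hi.1, hyx i hi.1 hi.2⟩ : i ∈ {i ∈ T | x (P.root i) ≠ 0})) hle
    intro i hi
    by_contra hxi
    have : i ∈ {i ∈ T | y (P.root i) ≠ 0} := by
      rw [heq]
      exact ⟨hD.subset hi.1, hxi⟩
    exact this.2 (hyD i hi)
  -- An element of `C` on which `x` does not vanish is the lowest root of this component, because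
  -- `x` attains its minimum `-1` there.
  have hlow : ∀ c ∈ C, x (P.root c) ≠ 0 → P.IsLowestRoot K c := by
    intro c hc hxc
    have hxc' : x (P.root c) = -1 := by
      obtain ⟨n, hn⟩ := hx.exists_int c hc
      have h₁ := hx.nonpos c hc
      have h₂ := (abs_le.mp (hx.abs_le_one c (hCT' hc))).1
      rw [hn] at h₁ h₂ hxc ⊢
      norm_cast at h₁ h₂ hxc ⊢
      omega
    have hcD : -P.root c ∈ AddSubmonoid.closure (P.root '' D) := by
      refine (hD.mem_or_neg_mem c (hCT' hc)).resolve_left fun h' ↦ ?_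
      have := apply_nonneg_of_mem_closure h' x hxD
      linarith
    have hcK : -P.root c ∈ AddSubmonoid.closure (P.root '' K) := by
      refine (hDpi.mem_closure_component hK
        (P.neg_mem_range_root_iff.mpr (mem_range_self c)) hcD).resolve_right fun h' ↦ ?_
      have := apply_eq_zero_of_mem_closure h' x hxK
      rw [map_neg] at this
      linarith
    refine IsLowestRoot.of_add_notMem hDpi hK hcK fun d hd ↦ ?_
    have hdD := hK.subset hd
    by_cases hxd : x (P.root d) = 0
    · have hdC : d ∈ C := (hDC.subset (⟨hdD, hxd⟩ : d ∈ {i ∈ D | x (P.root i) = 0})).1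
      rw [neg_add_eq_sub]
      exact hC.sub_notMem d hdC c hc
    · rintro ⟨k, hk⟩
      have hkT : k ∈ T := hT (by
        rw [mem_bracket, hk]
        exact add_mem (neg_mem (Submodule.subset_span ⟨c, hCT' hc, rfl⟩))
          (Submodule.subset_span ⟨d, hD.subset hdD, rfl⟩))
      have h₁ := (abs_le.mp (hx.abs_le_one k hkT)).2
      have h₂ := (hxD d hdD).lt_of_ne' hxd
      rw [hk, map_add, map_neg, hxc'] at h₁
      linarith
  obtain ⟨c, hc, hxc⟩ : ∃ c ∈ C, x (P.root c) ≠ 0 := by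
    by_contra! h'
    have : Submodule.span ℝ (P.root '' C) ≤ LinearMap.ker x := by
      rw [Submodule.span_le]
      rintro _ ⟨i, hi, rfl⟩
      exact h' i hi
    exact hxj 0 (by simpa using this (hTC (hD.subset hjD)))
  have huniq : ∀ i ∈ C, x (P.root i) ≠ 0 → i = c := fun i hi hxi ↦
    (hlow i hi hxi).unique (hDpi.mono hK.subset) (hlow c hc hxc)
  -- Outside of the zero set of `x`, which `C` and `D` share, both have a single element.
  have hDj : ∀ i ∈ D, x (P.root i) ≠ 0 → i = j := by
    have h₁ : {i ∈ C | x (P.root i) ≠ 0} = {c} := by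
      ext i
      exact ⟨fun hi ↦ huniq i hi.1 hi.2, by rintro rfl; exact ⟨hc, hxc⟩⟩
    have hcard (S : Set ι) : {i ∈ S | x (P.root i) = 0}.ncard +
        {i ∈ S | x (P.root i) ≠ 0}.ncard = S.ncard := by
      rw [← ncard_union_eq]
      · congr 1
        ext i
        simp only [mem_union, mem_ofPred_eq]
        tauto
      · exact Set.disjoint_left.mpr fun i h h' ↦ h'.2 h.2
    have h₂ := hcard C
    have h₃ := hcard D
    rw [hDC, hD.ncard_eq hC.linearIndepOn hspan] at h₃
    rw [h₁, ncard_singleton] at h₂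
    have h₄ : {i ∈ D | x (P.root i) ≠ 0}.ncard ≤ 1 := by omega
    intro i hi hxi
    exact (ncard_le_one (toFinite _)).mp h₄ i ⟨hi, hxi⟩ j ⟨hjD, fun h0 ↦ hxj 0 (by simp [h0])⟩
  refine ⟨D, ⟨hDpi, hC, K, hK, c, hlow c hc hxc, j, hjK, ?_⟩, ?_, ?_⟩
  · have hxj0 : x (P.root j) ≠ 0 := fun h0 ↦ hxj 0 (by simp [h0])
    have hzero (i : ι) (hi : x (P.root i) = 0) : i ∈ D ↔ i ∈ C :=
      ⟨fun h' ↦ (hDC.subset (⟨h', hi⟩ : i ∈ {i ∈ D | x (P.root i) = 0})).1,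
        fun h' ↦ (hDC.superset (⟨h', hi⟩ : i ∈ {i ∈ C | x (P.root i) = 0})).1⟩
    have hcj : c ≠ j := by
      rintro rfl
      obtain ⟨n, hn⟩ := hx.exists_int c hc
      exact hxj n hn
    ext i
    simp only [mem_sdiff, mem_insert_iff, mem_singleton_iff]
    by_cases hi : x (P.root i) = 0
    · have h₁ : i ≠ c := fun h' ↦ hxc (h' ▸ hi)
      have h₂ : i ≠ j := fun h' ↦ hxj0 (h' ▸ hi)
      simp [h₁, h₂, hzero i hi]
    · constructor
      · intro h'
        obtain rfl := huniq i h' hi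
        exact ⟨Or.inl rfl, hcj⟩
      · rintro ⟨rfl | h', hij⟩
        · exact hc
        · exact (hij (hDj i h' hi)).elim
  · rwa [hD.bracket_eq hT]
  · rw [hspan, hD.span_eq]

theorem IsPiSystem.exists_isRootBasis_reflTransGen {C : Set ι} (hC : P.IsPiSystem C) :
    ∃ B, P.IsRootBasis (P.rootsIn (Submodule.span ℝ (P.root '' C))) B ∧
      Relation.ReflTransGen P.ElementaryTransformation B C := by
  induction hn : Nat.card ι - (P.bracket C).ncard using Nat.strong_induction_on
    generalizing C with
  | _ n ih =>
    by_cases h : P.bracket C = P.rootsIn (Submodule.span ℝ (P.root '' C))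
    · exact ⟨C, h ▸ hC.isRootBasis_bracket, .refl⟩
    · obtain ⟨D, hDC, hlt, hspan⟩ := hC.exists_elementaryTransformation h
      have h₁ := ncard_lt_ncard hlt
      have h₂ := ncard_le_card (P.bracket D)
      obtain ⟨B, hB, hBD⟩ := ih _ (by omega) hDC.1 rfl
      exact ⟨B, hspan ▸ hB, hBD.tail hDC⟩

end Elementary

/-! ### Root subsystems and extension of bases -/

lemma isRootSubsystem_rootsIn (W : Submodule ℝ V) : P.IsRootSubsystem (P.rootsIn W) := by
  intro i hi j hj
  change P.root (P.reflectionPerm i j) ∈ W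
  rw [root_reflectionPerm, reflection_apply]
  exact sub_mem hj (W.smul_mem _ hi)

lemma isRootSubsystem_bracket [P.IsCrystallographic] (C : Set ι) :
    P.IsRootSubsystem (P.bracket C) := by
  intro i hi j hj
  rw [mem_bracket] at hi hj ⊢
  rw [root_reflectionPerm, reflection_apply, root_coroot'_eq_pairing, ← P.algebraMap_pairingIn ℤ,
    algebraMap_int_eq, eq_intCast, Int.cast_smul_eq_zsmul]
  exact sub_mem hj (Submodule.smul_mem _ _ hi)

lemma IsRootBasis.of_subset {T B C : Set ι} (hB : P.IsRootBasis T B) (hCB : C ⊆ B)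
    {W : Submodule ℝ V} (hW : W = Submodule.span ℝ (P.root '' C)) (hT : P.rootsIn W ⊆ T) :
    P.IsRootBasis (P.rootsIn W) C := by
  classical
  obtain ⟨x, hx⟩ := exists_dual_eq_on hB.linearIndepOn fun i ↦ if i ∈ C then 0 else 1
  have hxW : W ≤ LinearMap.ker x := by
    rw [hW, Submodule.span_le]
    rintro _ ⟨i, hi, rfl⟩
    simp [hx i (hCB hi), hi]
  have key {v : V} (hv : v ∈ AddSubmonoid.closure (P.root '' B)) (hvW : v ∈ W) :
      v ∈ AddSubmonoid.closure (P.root '' C) := by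
    refine closure_mono_image ?_ (mem_closure_setOf_apply_eq_zero hv x
      (fun i hi ↦ by rw [hx i hi]; split_ifs <;> norm_num) (hxW hvW))
    rintro i ⟨hi, hxi⟩
    by_contra hiC
    simp [hx i hi, hiC] at hxi
  refine isRootBasis_of_mem_or_neg_mem (fun i hi ↦ ?_) (hB.linearIndepOn.mono hCB) fun i hi ↦ ?_
  · change P.root i ∈ W
    exact hW ▸ Submodule.subset_span ⟨i, hi, rfl⟩
  · exact (hB.mem_or_neg_mem i (hT hi)).imp (fun h ↦ key h hi) fun h ↦ key h (neg_mem hi)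

lemma IsRootBasis.exists_univ_superset [Fintype ι] [P.IsRootSystem] [P.IsCrystallographic]
    {W : Submodule ℝ V} {C : Set ι} (hC : P.IsRootBasis (P.rootsIn W) C) :
    ∃ B, P.IsRootBasis univ B ∧ C ⊆ B := by
  obtain ⟨x, hxW, hx⟩ := Module.Dual.exists_forall_mem_ne_zero_of_forall_exists
    W.dualAnnihilator (fun i : {i // P.root i ∉ W} ↦ Dual.eval ℝ V (P.root i)) fun i ↦ by
      obtain ⟨f, hf, hfW⟩ := Submodule.exists_le_ker_of_notMem i.2
      exact ⟨f, (Submodule.mem_dualAnnihilator f).mpr fun w hw ↦ hfW hw, hf⟩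
  have hset : {i ∈ univ | x (P.root i) = 0} = P.rootsIn W := by
    ext i
    refine ⟨fun hi ↦ ?_, fun hi ↦ ⟨mem_univ i, (Submodule.mem_dualAnnihilator x).mp hxW _ hi⟩⟩
    by_contra hiW
    exact hx ⟨i, hiW⟩ hi.2
  obtain ⟨B, hB, -, hBC⟩ := exists_isRootBasis_apply_nonneg (subset_univ _) x (hset ▸ hC)
  exact ⟨B, hB, hBC ▸ sep_subset _ _⟩

end RootPairing

theorem mainTheorem2 {ι V N : Type*} [Finite ι] [AddCommGroup V] [Module ℝ V]
    [AddCommGroup N] [Module ℝ N] (P : RootPairing ι ℝ V N)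
    [P.IsRootSystem] [P.IsCrystallographic] [P.IsReduced]
    (C : Set ι) (hC : P.IsPiSystem C)
    (V' : Submodule ℝ V) (hV' : V' = Submodule.span ℝ (P.root '' C))
    (R' : Set ι) (hR' : R' = P.rootsIn V') :
    (P.IsRootSubsystem R' ∧ P.IsRootSubsystem (P.bracket C) ∧ P.bracket C ⊆ R' ∧
      P.IsRootBasis (P.bracket C) C) ∧
    (∃ B' : Set ι, P.IsRootBasis R' B' ∧ Relation.ReflTransGen P.ElementaryTransformation B' C) ∧
    ((∃ B : Set ι, P.IsRootBasis Set.univ B ∧ C ⊆ B) ↔ P.IsRootBasis R' C) ∧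
    (P.IsRootBasis R' C ↔ P.bracket C = R') := by
  have := Fintype.ofFinite ι
  have hsub : P.bracket C ⊆ R' := by
    subst hR' hV'
    exact fun i hi ↦ RootPairing.span_int_le_span_real hi
  refine ⟨⟨hR' ▸ RootPairing.isRootSubsystem_rootsIn V', RootPairing.isRootSubsystem_bracket C,
    hsub, hC.isRootBasis_bracket⟩, ?_, ⟨?_, ?_⟩, ⟨?_, ?_⟩⟩
  · subst hR' hV'
    exact hC.exists_isRootBasis_reflTransGen
  · rintro ⟨B, hB, hCB⟩
    exact hR' ▸ hB.of_subset hCB hV' (Set.subset_univ _)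
  · intro h
    subst hR'
    exact h.exists_univ_superset
  · intro h
    exact hsub.antisymm h.subset_bracket
  · rintro rfl
    exact hC.isRootBasis_bracket
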